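/- Let $m\ge 0$, let $A, C\in\mathbb C^{m\times m}$ be Hermitian and $B\in\mathbb C^{m\times m}$. Write $r(\cdot)$ for rank, $\mathscr R(\cdot)$ for the column space, $M^{\dagger}$ for the Moore--Penrose inverse of a complex matrix $M$, and put $E_M=I-MM^{\dagger}$, $F_M=I-M^{\dagger}M$. Consider the pair of matrix equations $$BX+XB^*=A,\qquad BXB^*=C. \tag{1}$$ (i) The pair (1) has a common Hermitian solution $X\in\mathbb C^{m\times m}$ if and only if $$\mathscr R(C)\subseteq\mathscr R(B),\quad r\begin{bmatrix}A&B\\B^*&0\end{bmatrix}=2r(B),\quad BC+CB^*=BAB^*,\quad \mathscr R(C-BA)\subseteq\mathscr R(B^2).$$ (ii) Put $G=[\,F_B,\,-B\,]\in\mathbb C^{m\times 2m}$, $H=\begin{bmatrix}B^*\\F_B\end{bmatrix}\in\mathbb C^{2m\times m}$ and, for $U\in\mathbb C^{2m\times 2m}$, $$Z(U)=[\,F_B,\,0\,]\,F_G\,U\,E_H\begin{bmatrix}I_m\\0\end{bmatrix}+[\,0,\,I_m\,]\,F_G\,U\,E_H\begin{bmatrix}0\\F_B\end{bmatrix}.$$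 If $X_0$ is any common Hermitian solution of (1), then the common Hermitian solutions of (1) are exactly the matrices $$X=X_0+Z(U)+Z(U)^*+F_BSF_B,$$ where $U\in\mathbb C^{2m\times 2m}$ and the Hermitian matrix $S\in\mathbb C^{m\times m}$ are arbitrary. (iii) The pair (1) has a unique common Hermitian solution if and only if $B$ is nonsingular and $BC+CB^*=BAB^*$. In that case the unique common Hermitian solution is $X=B^{-1}C(B^{-1})^*$. -/

import Mathlib

open scoped Matrix

namespace MatrixPair

variable {ι κ : Type*} [Fintype ι] [Fintype κ]

/-- The four Penrose equations: `X` is a Moore–Penrose inverse of the complex matrix `A`. -/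
structure IsMoorePenrose (A : Matrix ι κ ℂ) (X : Matrix κ ι ℂ) : Prop where
  mul_mul_self : A * X * A = A
  self_mul_mul : X * A * X = X
  isHermitian_left : (A * X)ᴴ = A * X
  isHermitian_right : (X * A)ᴴ = X * A

theorem IsMoorePenrose.unique {A : Matrix ι κ ℂ} {X Y : Matrix κ ι ℂ}
    (hX : IsMoorePenrose A X) (hY : IsMoorePenrose A Y) : X = Y := by
  have h1 : A * X = A * Y := by
    calc A * X = (A * X)ᴴ := hX.isHermitian_left.symm
      _ = (A * Y * (A * X))ᴴ := by rw [← Matrix.mul_assoc, hY.mul_mul_self]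
      _ = A * X * (A * Y) := by
        rw [Matrix.conjTranspose_mul, hX.isHermitian_left, hY.isHermitian_left]
      _ = A * Y := by rw [← Matrix.mul_assoc, hX.mul_mul_self]
  have h2 : X * A = Y * A := by
    calc X * A = (X * A)ᴴ := hX.isHermitian_right.symm
      _ = (X * A * (Y * A))ᴴ := by
        rw [Matrix.mul_assoc X A, ← Matrix.mul_assoc A Y A, hY.mul_mul_self]
      _ = Y * A * (X * A) := by
        rw [Matrix.conjTranspose_mul, hX.isHermitian_right, hY.isHermitian_right]
      _ = Y * A := by rw [Matrix.mul_assoc Y A, ← Matrix.mul_assoc A X A, hX.mul_mul_self]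
  calc X = X * A * X := hX.self_mul_mul.symm
    _ = Y * A * X := by rw [h2]
    _ = Y * A * Y := by rw [Matrix.mul_assoc, h1, Matrix.mul_assoc]
    _ = Y := hY.self_mul_mul

open scoped ComplexOrder in
theorem exists_isMoorePenrose (A : Matrix ι κ ℂ) : ∃ X, IsMoorePenrose A X := by
  classical
  -- A Hermitian Moore–Penrose inverse `P` of `N = Aᴴ * A`, by diagonalization.
  obtain ⟨P, hPh, hNPN, hPNP, hPN⟩ : ∃ P : Matrix κ κ ℂ, Pᴴ = P ∧
      (Aᴴ * A) * P * (Aᴴ * A) = Aᴴ * A ∧ P * (Aᴴ * A) * P = P ∧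
      (P * (Aᴴ * A))ᴴ = P * (Aᴴ * A) := by
    have hN : (Aᴴ * A).IsHermitian := Matrix.isHermitian_conjTranspose_mul_self A
    have hs := hN.spectral_theorem
    generalize Aᴴ * A = N at hN hs ⊢
    set φ := Unitary.conjStarAlgAut ℂ (Matrix κ κ ℂ) hN.eigenvectorUnitary with hφ
    set d : κ → ℂ := RCLike.ofReal ∘ hN.eigenvalues with hd
    have hdd : star d = d := by
      ext i; simp [hd]
    have hstar : ∀ e : κ → ℂ, (φ (Matrix.diagonal e))ᴴ = φ (Matrix.diagonal (star e)) := by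
      intro e
      rw [← Matrix.star_eq_conjTranspose, ← map_star, Matrix.star_eq_conjTranspose,
        Matrix.diagonal_conjTranspose]
    have hinv : star (fun i => (d i)⁻¹) = fun i => (d i)⁻¹ := by
      ext i; simp [hd]
    refine ⟨φ (Matrix.diagonal fun i => (d i)⁻¹), ?_, ?_, ?_, ?_⟩
    · rw [hstar, hinv]
    · rw [hs, ← map_mul, ← map_mul, Matrix.diagonal_mul_diagonal, Matrix.diagonal_mul_diagonal]
      congr 2; ext i
      by_cases h : d i = 0 <;> simp [h]
    · rw [hs, ← map_mul, ← map_mul, Matrix.diagonal_mul_diagonal, Matrix.diagonal_mul_diagonal]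
      congr 2; ext i
      by_cases h : d i = 0 <;> simp [h]
    · rw [hs, ← map_mul, Matrix.diagonal_mul_diagonal, hstar]
      congr 2; ext i
      have := congrFun hdd i
      have h' := congrFun hinv i
      simp only [Pi.star_apply] at this h'
      simp [Pi.star_apply, this]
  refine ⟨P * Aᴴ, ?_, ?_, ?_, ?_⟩
  · have h0 : Aᴴ * A * (P * (Aᴴ * A) - 1) = 0 := by
      rw [Matrix.mul_sub, ← Matrix.mul_assoc, hNPN, Matrix.mul_one, sub_self]
    rw [Matrix.conjTranspose_mul_self_mul_eq_zero, Matrix.mul_sub, Matrix.mul_one,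
      sub_eq_zero] at h0
    simpa only [Matrix.mul_assoc] using h0
  · calc P * Aᴴ * A * (P * Aᴴ) = P * (Aᴴ * A) * P * Aᴴ := by simp only [Matrix.mul_assoc]
      _ = P * Aᴴ := by rw [hPNP]
  · simp only [Matrix.conjTranspose_mul, Matrix.conjTranspose_conjTranspose, hPh,
      Matrix.mul_assoc]
  · rw [Matrix.mul_assoc, hPN]

/-- The Moore–Penrose inverse `A†` of a complex matrix: the unique solution of the four
Penrose equations. -/
noncomputable def pinv (A : Matrix ι κ ℂ) : Matrix κ ι ℂ :=
  Classical.choose (exists_isMoorePenrose A)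

theorem pinv_spec (A : Matrix ι κ ℂ) : IsMoorePenrose A (pinv A) :=
  Classical.choose_spec (exists_isMoorePenrose A)

/-- `E_A = I - A A†`. -/
noncomputable def projE [DecidableEq ι] (A : Matrix ι κ ℂ) : Matrix ι ι ℂ :=
  1 - A * pinv A

/-- `F_A = I - A† A`. -/
noncomputable def projF [DecidableEq κ] (A : Matrix ι κ ℂ) : Matrix κ κ ℂ :=
  1 - pinv A * A

/-- The range (column space) of a matrix. -/
def colSpace (A : Matrix ι κ ℂ) : Submodule ℂ (ι → ℂ) :=
  LinearMap.range A.mulVecLin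

/-- `X` is a common Hermitian solution of `B X + X B* = A` and `B X B* = C`. -/
def IsCommonHermitianSolution (A B C X : Matrix ι ι ℂ) : Prop :=
  X.IsHermitian ∧ B * X + X * Bᴴ = A ∧ B * X * Bᴴ = C

/-- With `G = [F_B, -B]` and `H = [B*; F_B]`, the matrix
`[F_B, 0] F_G U E_H [I; 0] + [0, I] F_G U E_H [0; F_B]`. -/
noncomputable def homogeneousPart [DecidableEq ι] (B : Matrix ι ι ℂ)
    (U : Matrix (ι ⊕ ι) (ι ⊕ ι) ℂ) : Matrix ι ι ℂ :=
  let G : Matrix ι (ι ⊕ ι) ℂ := Matrix.fromCols (projF B) (-B)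
  let H : Matrix (ι ⊕ ι) ι ℂ := Matrix.fromRows Bᴴ (projF B)
  let I : Matrix ι ι ℂ := 1
  let O : Matrix ι ι ℂ := 0
  Matrix.fromCols (projF B) O * projF G * U * projE H * Matrix.fromRows I O +
    Matrix.fromCols O I * projF G * U * projE H * Matrix.fromRows O (projF B)

end MatrixPair

open scoped Matrix
namespace MatrixPair

variable {ι κ μ : Type*} [Fintype ι] [Fintype κ]

/-! Write `R = B†`, `P = RB`, `F = 1 - P`, `E = 1 - BR`, and split `X` into blocks along `P` and
`F`. The second equation fixes `PXP = R C Rᴴ`, and `FXF` drops out of both equations. What remains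
is `K = BXF`, which must satisfy `EK = 0`, `BKᴴ = 0` and `K + Kᴴ = D` with `D = A - C Rᴴ - R C`. The
range condition on `C - BA` gives a first approximation `K₀` with `EK₀ = 0` and `BK₀ = BD`; the rank
condition and `BC + CBᴴ = BABᴴ` allow its Hermitian defect to be repaired
(`exists_add_conjTranspose_eq`). Necessity follows by substitution.

For the general solution, subtracting `X₀` leaves the homogeneous pair, where `PXP = 0`. The
matrices `W = F_G U E_H` are exactly those with `GW = 0` and `WH = 0`; these block equations make
`Z(U)` a homogeneous solution, and a suitable `W` yields `FXP + PXF`. Uniqueness then forces `F =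
0`, because `F S F` is free. -/

/-! ### Moore–Penrose projectors. -/

theorem mul_pinv_mul (A : Matrix ι κ ℂ) : A * pinv A * A = A := (pinv_spec A).mul_mul_self

theorem conjTranspose_mul_conjTranspose_pinv (A : Matrix ι κ ℂ) :
    Aᴴ * (pinv A)ᴴ = pinv A * A := by
  rw [← Matrix.conjTranspose_mul, (pinv_spec A).isHermitian_right]

theorem conjTranspose_pinv_mul_conjTranspose (A : Matrix ι κ ℂ) :
    (pinv A)ᴴ * Aᴴ = A * pinv A := by
  rw [← Matrix.conjTranspose_mul, (pinv_spec A).isHermitian_left]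

theorem mul_projF [DecidableEq κ] (A : Matrix ι κ ℂ) : A * projF A = 0 := by
  rw [projF, Matrix.mul_sub, ← Matrix.mul_assoc, mul_pinv_mul, Matrix.mul_one, sub_self]

theorem projE_mul [DecidableEq ι] (A : Matrix ι κ ℂ) : projE A * A = 0 := by
  rw [projE, Matrix.sub_mul, mul_pinv_mul, Matrix.one_mul, sub_self]

theorem projF_isHermitian [DecidableEq κ] (A : Matrix ι κ ℂ) : (projF A)ᴴ = projF A := by
  rw [projF, Matrix.conjTranspose_sub, (pinv_spec A).isHermitian_right,
    Matrix.conjTranspose_one]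

theorem projE_isHermitian [DecidableEq ι] (A : Matrix ι κ ℂ) : (projE A)ᴴ = projE A := by
  rw [projE, Matrix.conjTranspose_sub, (pinv_spec A).isHermitian_left,
    Matrix.conjTranspose_one]

theorem projF_mul_conjTranspose [DecidableEq κ] (A : Matrix ι κ ℂ) : projF A * Aᴴ = 0 := by
  rw [← projF_isHermitian, ← Matrix.conjTranspose_mul, mul_projF, Matrix.conjTranspose_zero]

theorem conjTranspose_mul_projE [DecidableEq ι] (A : Matrix ι κ ℂ) : Aᴴ * projE A = 0 := by
  rw [← projE_isHermitian, ← Matrix.conjTranspose_mul, projE_mul, Matrix.conjTranspose_zero]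

theorem projF_mul_of_mul_eq_zero [DecidableEq κ] {A : Matrix ι κ ℂ} {W : Matrix κ μ ℂ}
    (h : A * W = 0) : projF A * W = W := by
  rw [projF, Matrix.sub_mul, Matrix.mul_assoc, h, Matrix.mul_zero, sub_zero, Matrix.one_mul]

theorem mul_projE_of_mul_eq_zero [DecidableEq ι] {A : Matrix ι κ ℂ} {W : Matrix μ ι ℂ}
    (h : W * A = 0) : W * projE A = W := by
  rw [projE, Matrix.mul_sub, ← Matrix.mul_assoc, h, Matrix.zero_mul, sub_zero, Matrix.mul_one]

/-! ### Column spaces and the block rank condition. -/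

theorem colSpace_mul_le {l n o : Type*} [Fintype n] [Fintype o] (A : Matrix l n ℂ)
    (L : Matrix n o ℂ) :
    colSpace (A * L) ≤ colSpace A := by
  rw [colSpace, Matrix.mulVecLin_mul]
  exact LinearMap.range_comp_le_range _ _

theorem colSpace_le_iff {l n o : Type*} [Fintype n] [Fintype o] (M : Matrix l n ℂ)
    (N : Matrix l o ℂ) : colSpace M ≤ colSpace N ↔ ∃ L : Matrix o n ℂ, M = N * L := by
  classical
  refine ⟨fun h => ?_, ?_⟩
  · have hcol (j : n) : ∃ v, N *ᵥ v = M.col j := by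
      obtain ⟨v, hv⟩ := h ⟨Pi.single j 1, rfl⟩
      exact ⟨v, by simpa using hv⟩
    choose v hv using hcol
    refine ⟨Matrix.of fun i j => v j i, ?_⟩
    ext i j
    exact (congrFun (hv j) i).symm
  · rintro ⟨L, rfl⟩
    exact colSpace_mul_le N L

open scoped ComplexOrder in
/-- The rank of `[A, B; Bᴴ, 0]` is as small as possible exactly when `A` maps the kernel of `Bᴴ`
into the column space of `B`. -/
theorem rank_fromBlocks_eq_iff (A B : Matrix ι ι ℂ) :
    (Matrix.fromBlocks A B Bᴴ 0).rank = 2 * B.rank ↔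
      ∀ x, Bᴴ *ᵥ x = 0 → A *ᵥ x ∈ colSpace B := by
  let M : Matrix (ι ⊕ ι) (ι ⊕ ι) ℂ := Matrix.fromBlocks A B Bᴴ 0
  let V := colSpace M
  let inl : (ι → ℂ) →ₗ[ℂ] (ι ⊕ ι → ℂ) :=
    { toFun := fun u => Sum.elim u 0
      map_add' := fun u v => by ext (i | i) <;> simp
      map_smul' := fun c u => by ext (i | i) <;> simp }
  have hinl : Function.Injective inl := fun u v huv => by
    ext i; exact congrFun huv (Sum.inl i)
  -- Rank–nullity for the lower half of the column space of `M`: the image has dimension `r(B)`, and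
  -- the kernel always contains the column space of `B` padded by zero. The rank condition says that
  -- this inclusion is an equality.
  let snd : V →ₗ[ℂ] (ι → ℂ) := (LinearMap.funLeft ℂ ℂ Sum.inr).comp V.subtype
  have hsnd : LinearMap.range snd = colSpace Bᴴ := by
    ext w
    constructor
    · rintro ⟨⟨_, v, rfl⟩, rfl⟩
      refine ⟨v ∘ Sum.inl, ?_⟩
      ext i
      simp [snd, M, Matrix.fromBlocks_mulVec, LinearMap.funLeft]
    · rintro ⟨v, rfl⟩
      refine ⟨⟨M *ᵥ Sum.elim v 0, Sum.elim v 0, rfl⟩, ?_⟩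
      ext i
      simp [snd, M, Matrix.fromBlocks_mulVec, LinearMap.funLeft]
  have hk := LinearMap.finrank_range_add_finrank_ker snd
  have hr : Module.finrank ℂ (colSpace Bᴴ) = B.rank := B.rank_conjTranspose
  have hV : Module.finrank ℂ V = (Matrix.fromBlocks A B Bᴴ 0).rank := rfl
  rw [hsnd, hr, hV, ← Submodule.finrank_map_subtype_eq] at hk
  have hB : Module.finrank ℂ ((colSpace B).map inl) = B.rank :=
    (Submodule.equivMapOfInjective inl hinl (colSpace B)).finrank_eq.symm
  have hle : (colSpace B).map inl ≤ (LinearMap.ker snd).map V.subtype := by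
    rintro _ ⟨_, ⟨y, rfl⟩, rfl⟩
    have hy : M *ᵥ Sum.elim 0 y = inl (B *ᵥ y) := by
      ext (i | i) <;> simp [M, Matrix.fromBlocks_mulVec, inl]
    refine ⟨⟨inl (B *ᵥ y), Sum.elim 0 y, hy⟩, ?_, rfl⟩
    ext i
    simp [snd, inl, LinearMap.funLeft]
  constructor
  · intro h x hx
    have heq := Submodule.eq_of_le_of_finrank_eq hle (by omega)
    have hxA : M *ᵥ Sum.elim x 0 = inl (A *ᵥ x) := by
      ext (i | i) <;> simp [M, Matrix.fromBlocks_mulVec, inl, hx]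
    have hmem : inl (A *ᵥ x) ∈ (colSpace B).map inl := by
      rw [heq]
      refine ⟨⟨inl (A *ᵥ x), Sum.elim x 0, hxA⟩, ?_, rfl⟩
      ext i
      simp [snd, inl, LinearMap.funLeft]
    obtain ⟨y, hyB, hy⟩ := hmem
    rwa [← hinl hy]
  · intro h
    have hge : (LinearMap.ker snd).map V.subtype ≤ (colSpace B).map inl := by
      rintro _ ⟨⟨_, v, rfl⟩, hv, rfl⟩
      have hv0 : Bᴴ *ᵥ (v ∘ Sum.inl) = 0 := by
        rw [← LinearMap.mem_ker.1 hv]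
        ext i
        simp [snd, M, Matrix.fromBlocks_mulVec, LinearMap.funLeft]
      refine ⟨A *ᵥ (v ∘ Sum.inl) + B *ᵥ (v ∘ Sum.inr), add_mem (h _ hv0) ⟨_, rfl⟩, ?_⟩
      ext (i | i) <;> simp [inl, M, Matrix.fromBlocks_mulVec, hv0]
    rw [← le_antisymm hle hge, hB] at hk
    omega

/-- The range of `E_B` lies in the kernel of `Bᴴ`, so the columns of `A E_B` lie in the column space
of `B`, which `E_B` kills. -/
theorem projE_mul_mul_projE_of_rank_fromBlocks [DecidableEq ι] {A B : Matrix ι ι ℂ}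
    (h : (Matrix.fromBlocks A B Bᴴ 0).rank = 2 * B.rank) : projE B * A * projE B = 0 := by
  have hle : colSpace (A * projE B) ≤ colSpace B := by
    rintro _ ⟨v, rfl⟩
    have hy := (rank_fromBlocks_eq_iff A B).1 h (projE B *ᵥ v) (by
      rw [Matrix.mulVec_mulVec, conjTranspose_mul_projE, Matrix.zero_mulVec])
    simpa using hy
  obtain ⟨L, hL⟩ := (colSpace_le_iff _ _).1 hle
  rw [Matrix.mul_assoc, hL, ← Matrix.mul_assoc, projE_mul, Matrix.zero_mul]

theorem rank_fromBlocks_mul_add_mul_conjTranspose (B X : Matrix ι ι ℂ) :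
    (Matrix.fromBlocks (B * X + X * Bᴴ) B Bᴴ 0).rank = 2 * B.rank := by
  refine (rank_fromBlocks_eq_iff _ B).2 fun x hx => ⟨X *ᵥ x, ?_⟩
  simp [Matrix.add_mulVec, ← Matrix.mulVec_mulVec, hx]

/-! ### Solvability of the pair. -/

/-- A Hermitian matrix that vanishes as a form on the sum of the ranges of two Hermitian matrices
is `J + Jᴴ` for some `J` that both of these annihilate from the left. -/
theorem exists_add_conjTranspose_eq [DecidableEq ι] {E P T : Matrix ι ι ℂ} (hE : Eᴴ = E)
    (hP : Pᴴ = P) (hT : Tᴴ = T) (hEE : E * T * E = 0) (hEP : E * T * P = 0)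
    (hPP : P * T * P = 0) : ∃ J, E * J = 0 ∧ P * J = 0 ∧ J + Jᴴ = T := by
  have hPE : P * T * E = 0 := by
    simpa [hE, hP, hT, Matrix.mul_assoc] using congrArg Matrix.conjTranspose hEP
  set N := Matrix.fromCols E P with hN
  have hTN : Nᴴ * T * N = 0 := by
    rw [hN, Matrix.conjTranspose_fromCols_eq_fromRows_conjTranspose, hE, hP,
      Matrix.fromRows_mul, Matrix.fromRows_mul_fromCols, hEE, hEP, hPE, hPP,
      Matrix.fromBlocks_zero]
  have hNL : Nᴴ * projE N = 0 := conjTranspose_mul_projE N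
  rw [hN, Matrix.conjTranspose_fromCols_eq_fromRows_conjTranspose, hE, hP, Matrix.fromRows_mul,
    ← Matrix.fromRows_zero, Matrix.fromRows_inj.eq_iff, ← hN] at hNL
  have hL : (projE N)ᴴ = projE N := projE_isHermitian N
  have hTL : (1 - projE N) * T * (1 - projE N) = 0 := by
    calc (1 - projE N) * T * (1 - projE N) = (N * pinv N)ᴴ * T * (N * pinv N) := by
          rw [(pinv_spec N).isHermitian_left, projE, sub_sub_cancel]
      _ = (pinv N)ᴴ * (Nᴴ * T * N) * pinv N := by
          simp only [Matrix.conjTranspose_mul, Matrix.mul_assoc]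
      _ = 0 := by simp [hTN]
  generalize projE N = L at *
  -- `L` projects onto the common kernel of `E` and `P`. By `hTL`, `T = LT + TL - LTL`; the factor
  -- `1/2` shares `LTL` equally between `J` and `Jᴴ`.
  refine ⟨L * T - (1 / 2 : ℂ) • (L * T * L), ?_, ?_, ?_⟩
  · simp [Matrix.mul_sub, ← Matrix.mul_assoc, hNL.1]
  · simp [Matrix.mul_sub, ← Matrix.mul_assoc, hNL.2]
  · have h2 : T = L * T + T * L - L * T * L := by
      rw [← sub_eq_zero, ← hTL]; noncomm_ring
    simp only [Matrix.conjTranspose_sub, Matrix.conjTranspose_smul, Matrix.conjTranspose_mul,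
      hL, hT]
    conv_rhs => rw [h2]
    simp [← Matrix.mul_assoc]
    module

variable [DecidableEq ι] {A B C X : Matrix ι ι ℂ}

theorem IsCommonHermitianSolution.conditions (h : IsCommonHermitianSolution A B C X) :
    colSpace C ≤ colSpace B ∧ (Matrix.fromBlocks A B Bᴴ 0).rank = 2 * B.rank ∧
      B * C + C * Bᴴ = B * A * Bᴴ ∧ colSpace (C - B * A) ≤ colSpace (B ^ 2) := by
  obtain ⟨-, rfl, rfl⟩ := h
  refine ⟨(colSpace_le_iff _ _).2 ⟨X * Bᴴ, by noncomm_ring⟩,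
    rank_fromBlocks_mul_add_mul_conjTranspose B X, by noncomm_ring,
    (colSpace_le_iff _ _).2 ⟨-X, by noncomm_ring⟩⟩

theorem exists_isCommonHermitianSolution (hA : A.IsHermitian) (hC : C.IsHermitian)
    (hCB : colSpace C ≤ colSpace B)
    (hrank : (Matrix.fromBlocks A B Bᴴ 0).rank = 2 * B.rank)
    (hABC : B * C + C * Bᴴ = B * A * Bᴴ)
    (hCBA : colSpace (C - B * A) ≤ colSpace (B ^ 2)) :
    ∃ X, IsCommonHermitianSolution A B C X := by
  obtain ⟨Y, hY⟩ := (colSpace_le_iff _ _).1 hCB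
  obtain ⟨L, hL⟩ := (colSpace_le_iff _ _).1 hCBA
  have hEA := projE_mul_mul_projE_of_rank_fromBlocks hrank
  have hA' : Aᴴ = A := hA
  have hC' : Cᴴ = C := hC
  set R := pinv B with hR
  have hBRB : B * R * B = B := mul_pinv_mul B
  have hBR : Rᴴ * Bᴴ = B * R := conjTranspose_pinv_mul_conjTranspose B
  have hRB : Bᴴ * Rᴴ = R * B := conjTranspose_mul_conjTranspose_pinv B
  have hEB : projE B * B = 0 := projE_mul B
  have hBE : Bᴴ * projE B = 0 := conjTranspose_mul_projE B
  have hE' : (projE B)ᴴ = projE B := projE_isHermitian B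
  have hQC : B * R * C = C := by rw [hY, ← mul_assoc, hBRB]
  have hCQ : C * (B * R) = C := by
    have := congrArg Matrix.conjTranspose hQC
    rwa [Matrix.conjTranspose_mul, Matrix.conjTranspose_mul, hC', hBR] at this
  have hEC : projE B * C = 0 := by rw [hY, ← mul_assoc, hEB, zero_mul]
  have hCE : C * projE B = 0 := by
    rw [← hC', ← hE', ← Matrix.conjTranspose_mul, hEC, Matrix.conjTranspose_zero]
  have hPB : R * B * Bᴴ = Bᴴ := by
    rw [← hRB, ← Matrix.conjTranspose_mul, ← Matrix.conjTranspose_mul, ← mul_assoc, hBRB]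
  have hP' : (R * B)ᴴ = R * B := (pinv_spec B).isHermitian_right
  -- For a solution `X`, `B X F_B = B X - C Rᴴ`, and `D` is the sum of this matrix and its adjoint.
  set D := A - C * Rᴴ - R * C with hD
  have hD' : Dᴴ = D := by
    simp only [hD, Matrix.conjTranspose_sub, Matrix.conjTranspose_mul, hA', hC',
      Matrix.conjTranspose_conjTranspose]
    abel
  have hEDE : projE B * D * projE B = 0 := by
    linear_combination (norm := (simp only [hD]; noncomm_ring))
      hEA - hEC * (Rᴴ * projE B) - projE B * R * hCE
  have hBDB : B * D * Bᴴ = 0 := by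
    linear_combination (norm := (simp only [hD]; noncomm_ring))
      -hABC - B * C * hBR - B * hCQ - hQC * Bᴴ
  -- a matrix `K₀` in the column space of `B` with `B K₀ = B D`
  obtain ⟨K₀, hEK₀, hBK₀⟩ : ∃ K₀, projE B * K₀ = 0 ∧ B * K₀ = B * D := by
    -- With `C = B Y` and `C - B A = B² L`, `B D = B A - C - B C Rᴴ = B² (-L - Y Rᴴ)`.
    refine ⟨B * (-L - Y * Rᴴ), by rw [← mul_assoc, hEB, zero_mul], ?_⟩
    linear_combination (norm := (simp only [hD]; noncomm_ring)) hQC + B * hY * Rᴴ + hL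
  have hK₀E : K₀ᴴ * projE B = 0 := by
    rw [← hE', ← Matrix.conjTranspose_mul, hEK₀, Matrix.conjTranspose_zero]
  have hK₀B : K₀ᴴ * Bᴴ = D * Bᴴ := by
    rw [← Matrix.conjTranspose_mul, hBK₀, Matrix.conjTranspose_mul, hD']
  obtain ⟨J, hEJ, hPJ, hJ⟩ := exists_add_conjTranspose_eq (T := D - K₀ - K₀ᴴ) hE' hP'
    (by simp only [Matrix.conjTranspose_sub, hD', Matrix.conjTranspose_conjTranspose]; abel)
    (by linear_combination (norm := noncomm_ring) hEDE - hEK₀ * projE B - projE B * hK₀E)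
    (by
      rw [← hRB]
      linear_combination (norm := noncomm_ring) -hEK₀ * (Bᴴ * Rᴴ) - projE B * hK₀B * Rᴴ)
    (by
      nth_rewrite 2 [← hRB]
      linear_combination (norm := noncomm_ring)
        -R * hBK₀ * (Bᴴ * Rᴴ) - R * B * hK₀B * Rᴴ - R * hBDB * Rᴴ)
  have hBJ : B * J = 0 := by
    linear_combination (norm := noncomm_ring) B * hPJ - hBRB * J
  obtain ⟨K, hKD, hEK, hBK⟩ : ∃ K, K + Kᴴ = D ∧ projE B * K = 0 ∧ B * K = B * D :=
    ⟨K₀ + J, by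
      rw [Matrix.conjTranspose_add]
      linear_combination (norm := noncomm_ring) hJ, by rw [mul_add, hEK₀, hEJ, add_zero],
      by rw [mul_add, hBK₀, hBJ, add_zero]⟩
  have hBK' : B * Kᴴ = 0 := by
    linear_combination (norm := noncomm_ring) B * hKD - hBK
  have hKB : K * Bᴴ = 0 := by
    rw [← K.conjTranspose_conjTranspose, ← Matrix.conjTranspose_mul, hBK',
      Matrix.conjTranspose_zero]
  have hQK : B * R * K = K := by
    rw [projE, sub_mul, one_mul, sub_eq_zero] at hEK
    exact hEK.symm
  have hKQ : Kᴴ * (B * R) = Kᴴ := by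
    rw [← hBR, ← Matrix.conjTranspose_mul, ← Matrix.conjTranspose_mul, hQK]
  -- The three terms are the blocks `PXP`, `PXF` and `FXP`; the free block `FXF` is taken to be
  -- zero. Here `B X = C Rᴴ + K`.
  refine ⟨R * C * Rᴴ + R * K + Kᴴ * Rᴴ, ?_, ?_, ?_⟩
  · simp only [Matrix.IsHermitian, Matrix.conjTranspose_add, Matrix.conjTranspose_mul, hC',
      Matrix.conjTranspose_conjTranspose, mul_assoc]
    abel
  · linear_combination (norm := (simp only [hD]; noncomm_ring))
      hQC * Rᴴ + hQK + hBK' * Rᴴ + R * C * hBR + R * hCQ + R * hKB + Kᴴ * hBR + hKQ + hKD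
  · linear_combination (norm := noncomm_ring)
      hQC * (Rᴴ * Bᴴ) + C * hBR + hCQ + hQK * Bᴴ + hKB + hBK' * (Rᴴ * Bᴴ)

/-! ### The homogeneous pair. -/

/-- The hypotheses are the blocks of `GW = 0` and `WH = 0`, so `F_G` and `E_H` fix `W`. -/
theorem homogeneousPart_fromBlocks {W₁ W₂ W₃ W₄ : Matrix ι ι ℂ}
    (h1 : projF B * W₁ = B * W₃) (h2 : projF B * W₂ = B * W₄)
    (h3 : W₁ * Bᴴ + W₂ * projF B = 0) (h4 : W₃ * Bᴴ + W₄ * projF B = 0) :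
    homogeneousPart B (Matrix.fromBlocks W₁ W₂ W₃ W₄) = projF B * W₁ + W₄ * projF B := by
  have hG : Matrix.fromCols (projF B) (-B) * Matrix.fromBlocks W₁ W₂ W₃ W₄ = 0 := by
    rw [Matrix.fromCols_mul_fromBlocks]
    simp [h1, h2]
  have hH : Matrix.fromBlocks W₁ W₂ W₃ W₄ * Matrix.fromRows Bᴴ (projF B) = 0 := by
    rw [Matrix.fromBlocks_mul_fromRows, h3, h4, Matrix.fromRows_zero]
  simp only [homogeneousPart]
  rw [Matrix.mul_assoc (Matrix.fromCols (projF B) 0), projF_mul_of_mul_eq_zero hG,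
    Matrix.mul_assoc (Matrix.fromCols (projF B) 0), mul_projE_of_mul_eq_zero hH,
    Matrix.mul_assoc (Matrix.fromCols 0 1), projF_mul_of_mul_eq_zero hG,
    Matrix.mul_assoc (Matrix.fromCols 0 1), mul_projE_of_mul_eq_zero hH]
  simp [Matrix.fromCols_mul_fromBlocks, Matrix.fromCols_mul_fromRows]

theorem exists_homogeneousPart_eq_add (B : Matrix ι ι ℂ) (U : Matrix (ι ⊕ ι) (ι ⊕ ι) ℂ) :
    ∃ W₁ W₂ W₃ W₄ : Matrix ι ι ℂ, projF B * W₁ = B * W₃ ∧ projF B * W₂ = B * W₄ ∧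
      W₁ * Bᴴ + W₂ * projF B = 0 ∧ W₃ * Bᴴ + W₄ * projF B = 0 ∧
      homogeneousPart B U = projF B * W₁ + W₄ * projF B := by
  obtain ⟨W, hW⟩ : ∃ W, W = projF (Matrix.fromCols (projF B) (-B)) * U *
    projE (Matrix.fromRows Bᴴ (projF B)) := ⟨_, rfl⟩
  have hG : Matrix.fromCols (projF B) (-B) * W = 0 := by
    rw [hW, ← Matrix.mul_assoc, ← Matrix.mul_assoc, mul_projF, Matrix.zero_mul, Matrix.zero_mul]
  have hH : W * Matrix.fromRows Bᴴ (projF B) = 0 := by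
    rw [hW, Matrix.mul_assoc, projE_mul, Matrix.mul_zero]
  have hU : homogeneousPart B U =
      Matrix.fromCols (projF B) (0 : Matrix ι ι ℂ) * W *
          Matrix.fromRows (1 : Matrix ι ι ℂ) (0 : Matrix ι ι ℂ) +
        Matrix.fromCols (0 : Matrix ι ι ℂ) (1 : Matrix ι ι ℂ) * W *
          Matrix.fromRows (0 : Matrix ι ι ℂ) (projF B) := by
    simp only [hW, homogeneousPart, Matrix.mul_assoc]
  clear hW
  obtain ⟨W₁, W₂, W₃, W₄, rfl⟩ : ∃ W₁ W₂ W₃ W₄, W = Matrix.fromBlocks W₁ W₂ W₃ W₄ :=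
    ⟨_, _, _, _, W.fromBlocks_toBlocks.symm⟩
  rw [Matrix.fromCols_mul_fromBlocks, ← Matrix.fromCols_zero, Matrix.fromCols_inj.eq_iff] at hG
  rw [Matrix.fromBlocks_mul_fromRows, ← Matrix.fromRows_zero, Matrix.fromRows_inj.eq_iff] at hH
  refine ⟨W₁, W₂, W₃, W₄, ?_, ?_, hH.1, hH.2, ?_⟩
  · simpa [add_neg_eq_zero] using hG.1
  · simpa [add_neg_eq_zero] using hG.2
  · rw [hU]
    simp [Matrix.fromCols_mul_fromBlocks, Matrix.fromCols_mul_fromRows]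

/-- The part `F_B X P + P X F_B`, with `P = B† B`, of a Hermitian solution `X` of the homogeneous
equations is a value of `homogeneousPart`. -/
theorem exists_homogeneousPart_eq (h : IsCommonHermitianSolution 0 B 0 X) :
    ∃ U, homogeneousPart B U = projF B * X * (1 - projF B) + (1 - projF B) * X * projF B := by
  obtain ⟨-, h1, h2⟩ := h
  have hBF : B * projF B = 0 := mul_projF B
  have hFB : projF B * Bᴴ = 0 := projF_mul_conjTranspose B
  have hRB : Bᴴ * (pinv B)ᴴ = 1 - projF B := by
    rw [conjTranspose_mul_conjTranspose_pinv, projF, sub_sub_cancel]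
  have hPR : pinv B * B = 1 - projF B := by rw [projF, sub_sub_cancel]
  set R := pinv B with hR
  set F := projF B with hF
  have hFF : F * F = F := by linear_combination (norm := noncomm_ring) -R * hBF + hPR * F
  have hBXP : B * X * (1 - F) = 0 := by
    rw [← hRB, ← mul_assoc, h2, zero_mul]
  have hPXB : (1 - F) * X * Bᴴ = 0 := by
    rw [← hPR, mul_assoc, mul_assoc, ← mul_assoc B, h2, mul_zero]
  have hBR : B * R * (B * X) = B * X := by
    linear_combination (norm := noncomm_ring) B * hPR * X - hBF * X
  have hBQ : B * X * (Rᴴ * Bᴴ) = B * X := by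
    have hXBQ : Bᴴ * (Rᴴ * Bᴴ) = Bᴴ := by
      linear_combination (norm := noncomm_ring) hRB * Bᴴ - hFB
    linear_combination (norm := noncomm_ring) h1 * (Rᴴ * Bᴴ) - X * hXBQ - h1
  -- `W₁` and `W₄` are the two wanted blocks; `W₂` and `W₃` are chosen to match them, since `B W₄ =
  -- B X` and `B W₃ = -B X Rᴴ = X Bᴴ Rᴴ = F W₁`.
  refine ⟨_, (homogeneousPart_fromBlocks (W₁ := F * X * (1 - F)) (W₂ := B * X)
    (W₃ := -(R * (B * X) * Rᴴ)) (W₄ := (1 - F) * X * F) ?_ ?_ ?_ ?_).trans ?_⟩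
  · linear_combination (norm := noncomm_ring)
      hFF * X * (1 - F) + hPR * X * (1 - F) - R * hBXP - X * hRB + h1 * Rᴴ + hBR * Rᴴ
  · linear_combination (norm := noncomm_ring)
      F * h1 - h1 + hPXB + hBF * X * F + hBXP
  · linear_combination (norm := noncomm_ring)
      h1 - hPXB - hBXP - F * X * hFB
  · linear_combination (norm := noncomm_ring)
      (1 - F) * X * hFF - R * hBQ - hPR * X - R * hBXP + hPR * X * (1 - F)
  · linear_combination (norm := noncomm_ring) hFF * X * (1 - F) + (1 - F) * X * hFF

theorem isCommonHermitianSolution_zero (B : Matrix ι ι ℂ) (U : Matrix (ι ⊕ ι) (ι ⊕ ι) ℂ)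
    {S : Matrix ι ι ℂ} (hS : S.IsHermitian) :
    IsCommonHermitianSolution 0 B 0
      (homogeneousPart B U + (homogeneousPart B U)ᴴ + projF B * S * projF B) := by
  have hBF : B * projF B = 0 := mul_projF B
  have hFB : projF B * Bᴴ = 0 := projF_mul_conjTranspose B
  have hF' : (projF B)ᴴ = projF B := projF_isHermitian B
  obtain ⟨hZ1, hZ2⟩ : B * homogeneousPart B U + homogeneousPart B U * Bᴴ = 0 ∧
      B * homogeneousPart B U * Bᴴ = 0 := by
    obtain ⟨W₁, W₂, W₃, W₄, -, h2, h3, -, hU⟩ := exists_homogeneousPart_eq_add B U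
    rw [hU]
    constructor
    -- `B Z = B W₄ F = F W₂ F` cancels `Z Bᴴ = F W₁ Bᴴ = -F W₂ F`.
    · linear_combination (norm := noncomm_ring)
        hBF * W₁ + projF B * h3 + W₄ * hFB - h2 * projF B
    · linear_combination (norm := noncomm_ring) hBF * W₁ * Bᴴ + B * W₄ * hFB
  generalize homogeneousPart B U = Z at *
  have hZ1' : B * Zᴴ + Zᴴ * Bᴴ = 0 := by
    simpa [add_comm] using congrArg Matrix.conjTranspose hZ1
  have hZ2' : B * Zᴴ * Bᴴ = 0 := by
    simpa [mul_assoc] using congrArg Matrix.conjTranspose hZ2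
  refine ⟨?_, ?_, ?_⟩
  · have hS' : Sᴴ = S := hS
    simp only [Matrix.IsHermitian, Matrix.conjTranspose_add, Matrix.conjTranspose_mul, hF', hS',
      Matrix.conjTranspose_conjTranspose, mul_assoc]
    abel
  · linear_combination (norm := noncomm_ring)
      hZ1 + hZ1' + hBF * S * projF B + projF B * S * hFB
  · linear_combination (norm := noncomm_ring) hZ2 + hZ2' + hBF * S * projF B * Bᴴ

theorem isCommonHermitianSolution_iff_of_solution {X₀ : Matrix ι ι ℂ}
    (h₀ : IsCommonHermitianSolution A B C X₀) :
    IsCommonHermitianSolution A B C X ↔ IsCommonHermitianSolution 0 B 0 (X - X₀) := by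
  obtain ⟨h1, h2, h3⟩ := h₀
  refine ⟨fun ⟨k1, k2, k3⟩ => ⟨k1.sub h1, ?_, ?_⟩, fun ⟨k1, k2, k3⟩ => ⟨?_, ?_, ?_⟩⟩
  · linear_combination (norm := noncomm_ring) k2 - h2
  · linear_combination (norm := noncomm_ring) k3 - h3
  · simpa using k1.add h1
  · linear_combination (norm := noncomm_ring) k2 + h2
  · linear_combination (norm := noncomm_ring) k3 + h3

theorem isCommonHermitianSolution_zero_iff :
    IsCommonHermitianSolution 0 B 0 X ↔
      ∃ (U : Matrix (ι ⊕ ι) (ι ⊕ ι) ℂ) (S : Matrix ι ι ℂ), S.IsHermitian ∧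
        X = homogeneousPart B U + (homogeneousPart B U)ᴴ + projF B * S * projF B := by
  refine ⟨fun h => ?_, ?_⟩
  · have hX : Xᴴ = X := h.1
    -- The value of `Z` obtained below is Hermitian, so `Z + Zᴴ` doubles it; halving `X`
    -- compensates.
    have hh : IsCommonHermitianSolution 0 B 0 ((1 / 2 : ℂ) • X) := by
      obtain ⟨-, h2, h3⟩ := h
      refine ⟨by simp [Matrix.IsHermitian, hX], ?_, ?_⟩
      · rw [mul_smul_comm, smul_mul_assoc, ← smul_add, h2, smul_zero]
      · rw [mul_smul_comm, smul_mul_assoc, h3, smul_zero]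
    obtain ⟨U, hU⟩ := exists_homogeneousPart_eq hh
    refine ⟨U, X, h.1, ?_⟩
    have hP : projF B * X * (1 - projF B) + (1 - projF B) * X * projF B =
        X - projF B * X * projF B := by
      have hPXP : (1 - projF B) * X * (1 - projF B) = 0 := by
        have h3 := h.2.2
        have h4 := conjTranspose_mul_conjTranspose_pinv B
        have h5 : pinv B * B = 1 - projF B := by rw [projF, sub_sub_cancel]
        rw [h5] at h4
        nth_rewrite 1 [← h5]
        rw [← h4]
        linear_combination (norm := noncomm_ring) pinv B * h3 * (pinv B)ᴴ
      linear_combination (norm := noncomm_ring) -hPXP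
    have hZ : homogeneousPart B U = (1 / 2 : ℂ) • (X - projF B * X * projF B) := by
      rw [hU, ← hP]
      simp only [mul_smul_comm, smul_mul_assoc, smul_add]
    have hX' : (X - projF B * X * projF B)ᴴ = X - projF B * X * projF B := by
      simp only [Matrix.conjTranspose_sub, Matrix.conjTranspose_mul, projF_isHermitian, hX,
        mul_assoc]
    rw [hZ, Matrix.conjTranspose_smul, hX']
    simp
    module
  · rintro ⟨U, S, hS, rfl⟩
    exact isCommonHermitianSolution_zero B U hS

/-! ### Uniqueness. -/

/-- Taking `U = 0` and `S = 1` perturbs the solution by `F_B F_B = F_Bᴴ F_B`, which vanishes only if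
`F_B` does. -/
theorem projF_eq_zero_of_unique (h : ∃! X, IsCommonHermitianSolution A B C X) :
    projF B = 0 := by
  obtain ⟨X₀, h₀, huniq⟩ := h
  have h1 := huniq (X₀ + projF B * 1 * projF B)
    ((isCommonHermitianSolution_iff_of_solution h₀).2 (isCommonHermitianSolution_zero_iff.2
      ⟨0, 1, Matrix.isHermitian_one, by simp [homogeneousPart]⟩))
  rw [add_eq_left, mul_one] at h1
  nth_rewrite 1 [← projF_isHermitian] at h1
  open scoped ComplexOrder in exact Matrix.conjTranspose_mul_self_eq_zero.1 h1

/-- The second equation alone determines `X`; conjugating the compatibility identity by `B⁻¹` gives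
the first. -/
theorem isCommonHermitianSolution_iff_of_isUnit (hC : C.IsHermitian) (hB : IsUnit B)
    (h : B * C + C * Bᴴ = B * A * Bᴴ) :
    IsCommonHermitianSolution A B C X ↔ X = B⁻¹ * C * (B⁻¹)ᴴ := by
  have hdet := (Matrix.isUnit_iff_isUnit_det B).1 hB
  have hl : B⁻¹ * B = 1 := Matrix.nonsing_inv_mul B hdet
  have hr : B * B⁻¹ = 1 := Matrix.mul_nonsing_inv B hdet
  have hl' : Bᴴ * (B⁻¹)ᴴ = 1 := by
    rw [← Matrix.conjTranspose_mul, hl, Matrix.conjTranspose_one]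
  have hr' : (B⁻¹)ᴴ * Bᴴ = 1 := by
    rw [← Matrix.conjTranspose_mul, hr, Matrix.conjTranspose_one]
  constructor
  · rintro ⟨-, -, rfl⟩
    linear_combination (norm := noncomm_ring)
      -hl * X * (Bᴴ * (B⁻¹)ᴴ) - X * hl'
  · rintro rfl
    refine ⟨Matrix.isHermitian_mul_mul_conjTranspose _ hC, ?_, ?_⟩
    · linear_combination (norm := noncomm_ring) B⁻¹ * h * (B⁻¹)ᴴ + hr * C * (B⁻¹)ᴴ
        + B⁻¹ * C * hr' - hl * C * (B⁻¹)ᴴ - B⁻¹ * C * hl' + hl * A * (Bᴴ * (B⁻¹)ᴴ) + A * hl'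
    · linear_combination (norm := noncomm_ring) hr * C * ((B⁻¹)ᴴ * Bᴴ) + C * hr'

end MatrixPair

theorem mainTheorem9 (m : ℕ) (A B C : Matrix (Fin m) (Fin m) ℂ)
    (hA : A.IsHermitian) (hC : C.IsHermitian) :
    -- solvability
    ((∃ X, MatrixPair.IsCommonHermitianSolution A B C X) ↔
      (MatrixPair.colSpace C ≤ MatrixPair.colSpace B ∧
        (Matrix.fromBlocks A B Bᴴ 0).rank = 2 * B.rank ∧
        B * C + C * Bᴴ = B * A * Bᴴ ∧
        MatrixPair.colSpace (C - B * A) ≤ MatrixPair.colSpace (B ^ 2))) ∧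
    -- general common Hermitian solution
    (∀ X₀, MatrixPair.IsCommonHermitianSolution A B C X₀ →
      ∀ X, MatrixPair.IsCommonHermitianSolution A B C X ↔
        ∃ (U : Matrix (Fin m ⊕ Fin m) (Fin m ⊕ Fin m) ℂ) (S : Matrix (Fin m) (Fin m) ℂ),
          S.IsHermitian ∧
          X = X₀ + MatrixPair.homogeneousPart B U + (MatrixPair.homogeneousPart B U)ᴴ +
            MatrixPair.projF B * S * MatrixPair.projF B) ∧
    -- uniqueness
    ((∃! X, MatrixPair.IsCommonHermitianSolution A B C X) ↔
      (IsUnit B ∧ B * C + C * Bᴴ = B * A * Bᴴ)) ∧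
    (IsUnit B → B * C + C * Bᴴ = B * A * Bᴴ →
      ∀ X, MatrixPair.IsCommonHermitianSolution A B C X ↔ X = B⁻¹ * C * (B⁻¹)ᴴ) := by
  open MatrixPair in
  refine ⟨⟨fun ⟨X, hX⟩ => hX.conditions, fun ⟨h1, h2, h3, h4⟩ =>
    exists_isCommonHermitianSolution hA hC h1 h2 h3 h4⟩, fun X₀ h₀ X => ?_,
    ⟨fun h => ⟨?_, ?_⟩, fun ⟨hB, h⟩ => ?_⟩,
    fun hB h X => isCommonHermitianSolution_iff_of_isUnit hC hB h⟩
  · rw [isCommonHermitianSolution_iff_of_solution h₀, isCommonHermitianSolution_zero_iff]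
    simp only [sub_eq_iff_eq_add', ← add_assoc]
  · have hF := projF_eq_zero_of_unique h
    rw [projF, sub_eq_zero] at hF
    exact (Matrix.isUnit_iff_isUnit_det B).2 (Matrix.isUnit_det_of_left_inverse hF.symm)
  · obtain ⟨X, hX, -⟩ := h
    exact hX.conditions.2.2.1
  · exact ⟨_, (isCommonHermitianSolution_iff_of_isUnit hC hB h).2 rfl,
      fun X hX => (isCommonHermitianSolution_iff_of_isUnit hC hB h).1 hX⟩
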